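/- Consider a piecewise-deterministic queueing (PDQ) network with $n$ nodes besides the destination, $m$ directed links and a finite set of modes $\mathcal I=\{1,\dots,z\}$. The mode $i(t)$ is a continuous-time Markov chain with transition rate matrix $\Lambda$ that is ergodic, i.e. has a unique stationary distribution $\mathsf p$ ($\mathsf p\Lambda=0$, $\mathsf p\ge 0$, $\sum_i\mathsf p_i=1$). Link $e$ has capacity $u^i_e\ge 0$ in mode $i$ and queue length $q_e(t)\ge 0$. A routing policy $\phi:\mathcal I\times\mathbb R_+^m\to\mathbb R_+^m$, measurable in the queue lengths, gives the link inflows. It is admissible: if $d(i,q)\in\mathbb R^m$ denotes the flows that the links deliver to their heads, then $\mathbf e_1+A\,d(i,q)-B\,\phi(i,q)=0$ for all $(i,q)$, where $\mathbf e_1$ is the unit demand at the origin node and $A$, $B$ are the $n\times m$ incidence matrices of the links entering and leaving each node (this covers constant $d$ as well as $d=r$ below). The queues follow $$\frac{dq_e}{dt}=\phi_e(i,q)-r_e(\phi,i,q),\qquad r_e(\phi,i,q)=\begin{cases}u_e^i,& q_e>0,\\ \min\{\phi_e(i,q),u_e^i\},& q_e=0,\end{cases}$$ in integrated form, and $X(t)=(i(t),q(t))$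 is a time-homogeneous Markov process on $\mathcal I\times\mathbb R_+^m$ with transition kernels $P_t$. The network is stable if $(P_t)_{t\ge0}$ has exactly one invariant probability measure and, from every initial state, the law of $X(t)$ converges to it weakly as $t\to\infty$. Let $\bar u_e=\sum_{i}\mathsf p_i u_e^i$ be the mean capacity of link $e$. If the network is stable, then from every initial state the time-average flows $\bar\phi_e=\lim_{T\to\infty}\frac1T\int_0^T\phi_e(i(t),q(t))\,dt$ (almost sure limits) satisfy $\bar\phi_e\le\bar u_e$ for every link $e$, that is, $\bar\phi\le\bar u$. Moreover, without presupposing that these limits exist, almost surely $$\liminf_{T\to\infty}\frac1T\int_0^T\phi_e(i(t),q(t))\,dt\le\bar u_e\quad\text{for every link } e.$$ -/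

import Mathlib

open MeasureTheory ProbabilityTheory Filter Topology
open scoped NNReal Matrix

noncomputable section

/-- Vectors of queue lengths on `m` links, that is, points of `ℝ₊ᵐ`. -/
abbrev QueueVector (m : ℕ) : Type := Fin m → ℝ≥0

/-- The hybrid state space `I × ℝ₊ᵐ`, with the finite set of modes `I = Fin z` (discrete). -/
abbrev HybridState (m z : ℕ) : Type := Fin z × QueueVector m

/-- A routing policy: the inflows of the links, as a function of the mode and the queues. -/
abbrev RoutingPolicy (m z : ℕ) : Type := Fin z → QueueVector m → Fin m → ℝ≥0

/-- `p` is a stationary distribution of the finite Markov chain with rate matrix `Q`. -/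
def IsStationaryDistribution {z : ℕ} (Q : Matrix (Fin z) (Fin z) ℝ) (p : Fin z → ℝ) : Prop :=
  (∀ i, 0 ≤ p i) ∧ ∑ i, p i = 1 ∧ p ᵥ* Q = 0

/-- The data of a PDQ network with `n` nodes (the destination not counted), `m` links and `z`
modes. A link whose head is `none` ends at the destination. -/
structure PDQNetwork (n m z : ℕ) where
  /-- the node that a link leaves -/
  tail : Fin m → Fin n
  /-- the node that a link enters (`none` for the destination) -/
  head : Fin m → Option (Fin n)
  /-- the node at which the unit demand enters the network -/
  origin : Fin n
  /-- the capacity of each link in each mode -/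
  capacity : Fin z → Fin m → ℝ≥0
  /-- the transition rate matrix of the mode process -/
  rate : Matrix (Fin z) (Fin z) ℝ
  rate_nonneg : ∀ i j, i ≠ j → 0 ≤ rate i j
  rate_row_sum : ∀ i, ∑ j, rate i j = 0
  /-- the mode process is ergodic: it has exactly one stationary distribution -/
  ergodic : ∃! p : Fin z → ℝ, IsStationaryDistribution rate p

namespace PDQNetwork

variable {n m z : ℕ} (N : PDQNetwork n m z)

/-- The steady-state distribution of the modes. -/
def steadyState : Fin z → ℝ := N.ergodic.exists.choose

/-- The mean capacity `ū` of the links. -/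
def meanCapacity (e : Fin m) : ℝ := ∑ i, N.steadyState i * (N.capacity i e : ℝ)

/-- The discharge `r` of the links: the capacity of the mode when there is a queue, and the
smaller of inflow and capacity when there is none. -/
def discharge (φ : RoutingPolicy m z) (i : Fin z) (q : QueueVector m) (e : Fin m) : ℝ≥0 :=
  if 0 < q e then N.capacity i e else min (φ i q e) (N.capacity i e)

/-- The incidence matrix of nodes and the links that enter them. -/
def inMatrix : Matrix (Fin n) (Fin m) ℝ :=
  Matrix.of fun v e => if N.head e = some v then 1 else 0

/-- The incidence matrix of nodes and the links that leave them. -/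
def outMatrix : Matrix (Fin n) (Fin m) ℝ :=
  Matrix.of fun v e => if N.tail e = v then 1 else 0

/-- Admissibility of the policy `φ` when the links deliver the flows `d` to their heads: flow is
conserved at all nodes. Interacting links are the case `d = N.discharge φ`, and non-interacting
links are the case of a constant `d`. -/
structure IsAdmissible (φ : RoutingPolicy m z) (d : Fin z → QueueVector m → Fin m → ℝ) :
    Prop where
  measurable : ∀ i, Measurable (φ i)
  conservation : ∀ i q,
    Pi.single N.origin 1 + N.inMatrix *ᵥ d i q - N.outMatrix *ᵥ (fun e => (φ i q e : ℝ)) = 0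

end PDQNetwork

/-- The hybrid process of a PDQ network under a routing policy, as a Markov process with one
probability law on the sample space for each initial state. -/
structure PDQProcess {n m z : ℕ} (N : PDQNetwork n m z) (φ : RoutingPolicy m z)
    (Ω : Type*) [MeasurableSpace Ω] where
  /-- the probability on the sample space for each initial state -/
  prob : Kernel (HybridState m z) Ω
  prob_markov : IsMarkovKernel prob
  /-- the history -/
  history : Filtration ℝ≥0 (inferInstance : MeasurableSpace Ω)
  /-- the mode -/
  mode : ℝ≥0 → Ω → Fin z
  /-- the queues -/
  queue : ℝ≥0 → Ω → QueueVector m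
  mode_adapted : ∀ t, Measurable[history t] (mode t)
  queue_adapted : ∀ t, Measurable[history t] (queue t)
  initial : ∀ x, ∀ᵐ ω ∂prob x, (mode 0 ω, queue 0 ω) = x
  /-- mode paths are right-continuous with left limits, hence piecewise constant -/
  mode_cadlag : ∀ x, ∀ᵐ ω ∂prob x, ∀ t,
    ContinuousWithinAt (fun s => mode s ω) (Set.Ici t) t ∧
      ∃ i, Tendsto (fun s => mode s ω) (𝓝[<] t) (𝓝 i)
  /-- the mode is a continuous-time Markov chain with the rate matrix of the network -/
  mode_chain : ∀ x (s t : ℝ≥0) (j : Fin z),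
    (prob x)[Set.indicator {ω | mode (s + t) ω = j} (fun _ => (1 : ℝ)) | history s] =ᵐ[prob x]
      fun ω => NormedSpace.exp ((t : ℝ) • N.rate) (mode s ω) j
  /-- the queues solve `dq/dt = φ - r`, in integrated form -/
  dynamics : ∀ x, ∀ᵐ ω ∂prob x, ∀ (t : ℝ≥0) (e : Fin m),
    IntervalIntegrable (fun s : ℝ => (φ (mode s.toNNReal ω) (queue s.toNNReal ω) e : ℝ) -
        (N.discharge φ (mode s.toNNReal ω) (queue s.toNNReal ω) e : ℝ)) volume 0 t ∧
    (queue t ω e : ℝ) = queue 0 ω e +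
      ∫ s in (0 : ℝ)..t, ((φ (mode s.toNNReal ω) (queue s.toNNReal ω) e : ℝ) -
        (N.discharge φ (mode s.toNNReal ω) (queue s.toNNReal ω) e : ℝ))
  /-- the state is a time-homogeneous Markov process -/
  markov : ∀ x (s t : ℝ≥0) (B : Set (HybridState m z)), MeasurableSet B →
    (prob x)[Set.indicator {ω | (mode (s + t) ω, queue (s + t) ω) ∈ B} (fun _ => (1 : ℝ)) |
        history s] =ᵐ[prob x]
      fun ω => (prob (mode s ω, queue s ω)).real {ω' | (mode t ω', queue t ω') ∈ B}

namespace PDQProcess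

variable {n m z : ℕ} {N : PDQNetwork n m z} {φ : RoutingPolicy m z}
  {Ω : Type*} [MeasurableSpace Ω] (X : PDQProcess N φ Ω)

/-- The hybrid state at time `t`. -/
def state (t : ℝ≥0) (ω : Ω) : HybridState m z := (X.mode t ω, X.queue t ω)

theorem measurable_state (t : ℝ≥0) : Measurable (X.state t) :=
  ((X.mode_adapted t).mono (X.history.le t) le_rfl).prodMk
    ((X.queue_adapted t).mono (X.history.le t) le_rfl)

/-- The transition kernel `P_t`: the law of the state at time `t`, from each initial state. -/
def transition (t : ℝ≥0) : Kernel (HybridState m z) (HybridState m z) :=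
  X.prob.map (X.state t)

theorem isProbabilityMeasure_transition (t : ℝ≥0) (x : HybridState m z) :
    IsProbabilityMeasure (X.transition t x) := by
  have := X.prob_markov
  have : IsMarkovKernel (X.transition t) := Kernel.IsMarkovKernel.map _ (X.measurable_state t)
  infer_instance

/-- The law of the state at time `t` from the initial state `x`, as a point of the space of
probability measures with the topology of weak convergence. -/
def stateLaw (x : HybridState m z) (t : ℝ≥0) : ProbabilityMeasure (HybridState m z) :=
  ⟨X.transition t x, X.isProbabilityMeasure_transition t x⟩

/-- A probability measure that the transition kernels preserve. -/
def IsInvariant (π : ProbabilityMeasure (HybridState m z)) : Prop :=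
  ∀ t, (X.transition t).Invariant (π : Measure (HybridState m z))

/-- Stability: there is exactly one invariant probability measure, and from every initial state
the law of the state converges to it. -/
def IsStable : Prop :=
  ∃ π : ProbabilityMeasure (HybridState m z), X.IsInvariant π ∧
    (∀ π', X.IsInvariant π' → π' = π) ∧
    ∀ x, Tendsto (X.stateLaw x) atTop (𝓝 π)

/-- The average inflow `(1/T) ∫₀ᵀ φ_e dt` of a link over the time interval `[0, T]`. -/
def averageFlow (e : Fin m) (T : ℝ) (ω : Ω) : ℝ :=
  (1 / T) * ∫ s in (0 : ℝ)..T, (φ (X.mode s.toNNReal ω) (X.queue s.toNNReal ω) e : ℝ)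

/-- `f` is the vector of time-average flows (almost sure limits) from the initial state `x`. -/
def IsTimeAverageFlow (x : HybridState m z) (f : Fin m → ℝ) : Prop :=
  ∀ᵐ ω ∂X.prob x, ∀ e, Tendsto (fun T => X.averageFlow e T ω) atTop (𝓝 (f e))

end PDQProcess

end

/-!
Along almost every path the queue `q_e` is the accumulated inflow of the link less its accumulated
discharge, and the discharge is at most the capacity. Hence
`averageFlow e T ≤ q_e(T) / T + (1 / T) ∫₀ᵀ u_e(i(s)) ds` (`PDQProcess.ae_averageFlow_le`).
Both terms on the right are controlled in probability.

* Stability makes the law of `q_e(T)` converge weakly, so it puts little mass far out and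
  `q_e(T) / T → 0` in probability (`PDQProcess.IsStable.tendstoInMeasure_queue_div`).
* The average of the capacity tends to its mean under the steady state, by a second moment
  computation (`PDQProcess.IsStable.tendstoInMeasure_average`). Its input is
  `exp (t Λ) h → ∑ p_i h_i` for each function `h` of the mode
  (`PDQProcess.IsStable.tendsto_exp_mulVec`), which also comes from stability: the law of the mode
  has a limit that is the same for all initial modes, and `p exp (t Λ) = p` identifies it.

A subsequence of the integer times along which both convergences hold almost surely bounds the
lower limit of the average flow by the mean capacity. A limit of the average flow, where it exists,
is its lower limit.
-/

/-! ### The mode process -/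

theorem IsStationaryDistribution.vecMul_exp_smul {z : ℕ} {Q : Matrix (Fin z) (Fin z) ℝ}
    {p : Fin z → ℝ} (hp : IsStationaryDistribution Q p) (t : ℝ) :
    p ᵥ* NormedSpace.exp (t • Q) = p := by
  open scoped Matrix.Norms.Operator in
  -- The matrix `P` all of whose rows are `p` intertwines `t • Q` and `0`.
  set P : Matrix (Fin z) (Fin z) ℝ := Matrix.of fun _ => p with hP
  have hPQ : P * Q = 0 := by
    ext i j
    exact congrFun hp.2.2 j
  have h : SemiconjBy P (t • Q) 0 := by
    rw [SemiconjBy, Matrix.mul_smul, hPQ, smul_zero, zero_mul]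
  have h' := h.exp_right
  rw [SemiconjBy, NormedSpace.exp_zero, one_mul] at h'
  ext j
  exact congrFun (congrFun h' j) j

theorem PDQNetwork.isStationaryDistribution_steadyState {n m z : ℕ} (N : PDQNetwork n m z) :
    IsStationaryDistribution N.rate N.steadyState :=
  N.ergodic.exists.choose_spec

namespace PDQProcess

variable {n m z : ℕ} {N : PDQNetwork n m z} {φ : RoutingPolicy m z}
  {Ω : Type*} [MeasurableSpace Ω] (X : PDQProcess N φ Ω)

theorem isProbabilityMeasure_prob (x : HybridState m z) : IsProbabilityMeasure (X.prob x) :=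
  X.prob_markov.isProbabilityMeasure x

theorem measurable_mode (t : ℝ≥0) : Measurable (X.mode t) :=
  (X.mode_adapted t).mono (X.history.le t) le_rfl

theorem integrable_comp_mode (x : HybridState m z) (h : Fin z → ℝ) (t : ℝ≥0) :
    Integrable (fun ω => h (X.mode t ω)) (X.prob x) := by
  have := X.isProbabilityMeasure_prob x
  exact Integrable.comp_measurable .of_finite (X.measurable_mode t)

/-- The Markov property of the modes, for functions of the mode. -/
theorem condExp_comp_mode (x : HybridState m z) (h : Fin z → ℝ) (s t : ℝ≥0) :
    (X.prob x)[fun ω => h (X.mode (s + t) ω) | X.history s] =ᵐ[X.prob x]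
      fun ω => (NormedSpace.exp ((t : ℝ) • N.rate) *ᵥ h) (X.mode s ω) := by
  have := X.isProbabilityMeasure_prob x
  have hsum : (fun ω => h (X.mode (s + t) ω)) =
      ∑ j, h j • Set.indicator {ω | X.mode (s + t) ω = j} (fun _ => (1 : ℝ)) := by
    ext ω
    simp [Set.indicator_apply]
  have hint : ∀ j : Fin z, Integrable
      (Set.indicator {ω | X.mode (s + t) ω = j} (fun _ => (1 : ℝ))) (X.prob x) := fun j =>
    (integrable_const 1).indicator (X.measurable_mode _ (measurableSet_singleton j))
  rw [hsum]
  refine (condExp_finsetSum (fun j _ => (hint j).smul (h j)) _).trans ?_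
  have hj : ∀ j, (X.prob x)[h j • Set.indicator {ω | X.mode (s + t) ω = j} (fun _ => (1 : ℝ)) |
      X.history s] =ᵐ[X.prob x]
        fun ω => h j * NormedSpace.exp ((t : ℝ) • N.rate) (X.mode s ω) j := fun j => by
    filter_upwards [condExp_smul (μ := X.prob x) (h j)
      (Set.indicator {ω | X.mode (s + t) ω = j} (fun _ => (1 : ℝ))) (X.history s),
      X.mode_chain x s t j] with ω h₁ h₂
    rw [h₁, Pi.smul_apply, h₂, smul_eq_mul]
  filter_upwards [ae_all_iff.2 hj] with ω hω
  simp only [Finset.sum_apply, hω, Matrix.mulVec, dotProduct]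
  exact Finset.sum_congr rfl fun j _ => mul_comm _ _

theorem integral_comp_mode_mul (x : HybridState m z) (g h : Fin z → ℝ) (s t : ℝ≥0) :
    ∫ ω, g (X.mode s ω) * h (X.mode (s + t) ω) ∂X.prob x =
      ∫ ω, g (X.mode s ω) * (NormedSpace.exp ((t : ℝ) • N.rate) *ᵥ h) (X.mode s ω)
        ∂X.prob x := by
  have := X.isProbabilityMeasure_prob x
  have hg : StronglyMeasurable[X.history s] fun ω => g (X.mode s ω) :=
    ((measurable_of_finite g).comp (X.mode_adapted s)).stronglyMeasurable
  have hgh : Integrable ((fun ω => g (X.mode s ω)) * fun ω => h (X.mode (s + t) ω))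
      (X.prob x) :=
    Integrable.comp_measurable (g := fun y : Fin z × Fin z => g y.1 * h y.2) .of_finite
      ((X.measurable_mode s).prodMk (X.measurable_mode (s + t)))
  rw [← integral_condExp (X.history.le s)]
  refine integral_congr_ae ?_
  filter_upwards [condExp_mul_of_stronglyMeasurable_left hg hgh
    (X.integrable_comp_mode x h (s + t)), X.condExp_comp_mode x h s t] with ω h₁ h₂
  exact h₁.trans (congrArg (g (X.mode s ω) * ·) h₂)

theorem integral_comp_mode (x : HybridState m z) (h : Fin z → ℝ) (t : ℝ≥0) :
    ∫ ω, h (X.mode t ω) ∂X.prob x = (NormedSpace.exp ((t : ℝ) • N.rate) *ᵥ h) x.1 := by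
  have := X.isProbabilityMeasure_prob x
  have h₁ := X.integral_comp_mode_mul x 1 h 0 t
  simp only [Pi.one_apply, one_mul, zero_add] at h₁
  rw [h₁, integral_congr_ae (g := fun _ => (NormedSpace.exp ((t : ℝ) • N.rate) *ᵥ h) x.1)]
  · simp
  · filter_upwards [X.initial x] with ω hω
    rw [← hω]

variable {X}

/-- Convergence of the mode distribution to the steady state. The weak convergence of the law of
the state gives a limit that does not depend on the initial mode, and integration against the
steady state identifies it. -/
theorem IsStable.tendsto_exp_mulVec (hX : X.IsStable) (h : Fin z → ℝ) (i : Fin z) :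
    Tendsto (fun t : ℝ≥0 => (NormedSpace.exp ((t : ℝ) • N.rate) *ᵥ h) i) atTop
      (𝓝 (∑ j, N.steadyState j * h j)) := by
  obtain ⟨π, -, -, hπ⟩ := hX
  let F : BoundedContinuousFunction (HybridState m z) ℝ :=
    (BoundedContinuousFunction.mkOfCompact ⟨h, continuous_of_discreteTopology⟩).compContinuous
      ⟨Prod.fst, continuous_fst⟩
  have hlim : ∀ k, Tendsto (fun t : ℝ≥0 => (NormedSpace.exp ((t : ℝ) • N.rate) *ᵥ h) k) atTop
      (𝓝 (∫ y, F y ∂(π : Measure (HybridState m z)))) := fun k => by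
    refine (ProbabilityMeasure.tendsto_iff_forall_integral_tendsto.1 (hπ (k, 0)) F).congr
      fun t => ?_
    change ∫ y, h y.1 ∂X.transition t (k, 0) = _
    rw [transition, Kernel.map_apply _ (X.measurable_state t),
      integral_map (f := fun y => h y.1) (X.measurable_state t).aemeasurable
        ((measurable_of_finite h).comp measurable_fst).aestronglyMeasurable]
    exact X.integral_comp_mode (k, 0) h t
  have hp := N.isStationaryDistribution_steadyState
  have h₁ : Tendsto (fun t : ℝ≥0 => N.steadyState ⬝ᵥ
      (NormedSpace.exp ((t : ℝ) • N.rate) *ᵥ h)) atTop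
      (𝓝 (∑ k, N.steadyState k * ∫ y, F y ∂(π : Measure (HybridState m z)))) :=
    tendsto_finsetSum _ fun k _ => (hlim k).const_mul _
  rw [← Finset.sum_mul, hp.2.1, one_mul] at h₁
  simp only [Matrix.dotProduct_mulVec, hp.vecMul_exp_smul] at h₁
  rw [show ∑ j, N.steadyState j * h j = _ from tendsto_nhds_unique tendsto_const_nhds h₁]
  exact hlim i

variable (X)

/-! ### Path measurability -/

/-- Joint measurability of the mode in time and chance, by approximation of the time from the
right; time is a measurable function `τ` of a parameter. -/
theorem aemeasurable_mode_prod (x : HybridState m z) {α : Type*} [MeasurableSpace α]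
    (μ : Measure α) [SFinite μ] {τ : α → ℝ≥0} (hτ : Measurable τ) :
    AEMeasurable (fun y : α × Ω => X.mode (τ y.1) y.2) (μ.prod (X.prob x)) := by
  have := X.isProbabilityMeasure_prob x
  -- `σ k t` is the first point of the grid of mesh `1 / (k + 1)` after `t`.
  let σ : ℕ → ℝ≥0 → ℝ≥0 := fun k t => (⌊(k + 1 : ℝ≥0) * t⌋₊ + 1 : ℝ≥0) / (k + 1)
  have hσ_le : ∀ k t, t ≤ σ k t := fun k t => by
    rw [le_div_iff₀ (by positivity), mul_comm]
    exact (Nat.lt_floor_add_one _).le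
  have hσ_tendsto : ∀ t, Tendsto (fun k => σ k t) atTop (𝓝[≥] t) := fun t => by
    refine tendsto_nhdsWithin_iff.2 ⟨?_, .of_forall fun k => hσ_le k t⟩
    have hup : Tendsto (fun k : ℕ => t + 1 / ((k : ℝ≥0) + 1)) atTop (𝓝 (t + 0)) :=
      tendsto_const_nhds.add (NNReal.tendsto_coe.1 <| by
        simpa using tendsto_one_div_add_atTop_nhds_zero_nat (𝕜 := ℝ))
    rw [add_zero] at hup
    refine tendsto_of_tendsto_of_tendsto_of_le_of_le tendsto_const_nhds hup
      (fun k => hσ_le k t) fun k => ?_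
    change (_ : ℝ≥0) / _ ≤ _
    rw [add_div]
    gcongr
    rw [div_le_iff₀ (by positivity), mul_comm t]
    exact Nat.floor_le (by positivity)
  refine aemeasurable_of_tendsto_metrizable_ae (f := fun k (y : α × Ω) =>
    X.mode (σ k (τ y.1)) y.2) atTop (fun k => ?_) ?_
  · have h₁ : Measurable fun y : ℕ × Ω => X.mode ((y.1 + 1 : ℝ≥0) / (k + 1)) y.2 :=
      measurable_from_prod_countable_right fun l =>
        X.measurable_mode ((l + 1 : ℝ≥0) / (k + 1))
    have h₂ : Measurable fun y : α × Ω => (⌊(k + 1 : ℝ≥0) * τ y.1⌋₊, y.2) :=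
      (Nat.measurable_floor.comp ((hτ.comp measurable_fst).const_mul _)).prodMk measurable_snd
    exact (h₁.comp h₂).aemeasurable
  · filter_upwards [Measure.quasiMeasurePreserving_snd.ae (X.mode_cadlag x)] with y hy
    exact (hy (τ y.1)).1.tendsto.comp (hσ_tendsto _)

/-- Almost every mode path is a measurable function of time. -/
theorem ae_aemeasurable_mode (x : HybridState m z) :
    ∀ᵐ ω ∂X.prob x, AEMeasurable (fun s : ℝ => X.mode s.toNNReal ω) volume := by
  have := X.isProbabilityMeasure_prob x
  have h := (X.aemeasurable_mode_prod x volume measurable_real_toNNReal).comp_quasiMeasurePreserving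
    (Measure.measurePreserving_swap (μ := X.prob x)).quasiMeasurePreserving
  obtain ⟨g, hg, hgeq⟩ := h
  filter_upwards [Measure.ae_ae_of_ae_prod hgeq] with ω hω
  exact ⟨fun s => g (ω, s), hg.comp measurable_prodMk_left, hω⟩

end PDQProcess

/-! ### The ergodic theorem for the modes, in probability -/

namespace PDQProcess

variable {n m z : ℕ} {N : PDQNetwork n m z} {φ : RoutingPolicy m z}
  {Ω : Type*} [MeasurableSpace Ω] (X : PDQProcess N φ Ω)

theorem abs_integral_comp_mode_mul_le (x : HybridState m z) {h : Fin z → ℝ} {M : ℝ}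
    (hM : ∀ i, |h i| ≤ M) (s t : ℝ≥0) :
    |∫ ω, h (X.mode s ω) * h (X.mode t ω) ∂X.prob x| ≤
      M * ∑ i, |(NormedSpace.exp ((nndist s t : ℝ) • N.rate) *ᵥ h) i| := by
  have := X.isProbabilityMeasure_prob x
  wlog hst : s ≤ t generalizing s t
  · rw [nndist_comm]
    simpa only [mul_comm (h (X.mode s _))] using this t s (le_of_not_ge hst)
  obtain ⟨t, rfl⟩ := exists_add_of_le hst
  have hd : (nndist s (s + t) : ℝ) = t := by
    simp [NNReal.dist_eq]
  rw [X.integral_comp_mode_mul x h h s t, hd, ← Real.norm_eq_abs]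
  refine (norm_integral_le_of_norm_le_const (.of_forall fun ω => ?_)).trans
    (b := M * (∑ i, |(NormedSpace.exp ((t : ℝ) • N.rate) *ᵥ h) i|) * (X.prob x).real Set.univ) ?_
  · rw [norm_mul, Real.norm_eq_abs, Real.norm_eq_abs]
    have hM0 : 0 ≤ M := (abs_nonneg _).trans (hM (X.mode s ω))
    gcongr
    · exact hM _
    · exact Finset.single_le_sum
        (f := fun i => |(NormedSpace.exp ((t : ℝ) • N.rate) *ᵥ h) i|)
        (fun _ _ => abs_nonneg _) (Finset.mem_univ _)
  · simp

/-- Fubini's theorem for the second moment of the average of a function of the mode over a finite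
measure `μ` of times, where the times are scaled by the factor `c`. -/
theorem integral_sq_integral_comp_mode (x : HybridState m z) (h : Fin z → ℝ) (μ : Measure ℝ)
    [IsFiniteMeasure μ] (c : ℝ) :
    Integrable (fun y : ℝ × ℝ => ∫ ω, h (X.mode (c * y.1).toNNReal ω) *
      h (X.mode (c * y.2).toNNReal ω) ∂X.prob x) (μ.prod μ) ∧
    Integrable (fun ω => (∫ s, h (X.mode (c * s).toNNReal ω) ∂μ) ^ 2) (X.prob x) ∧
    ∫ ω, (∫ s, h (X.mode (c * s).toNNReal ω) ∂μ) ^ 2 ∂X.prob x =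
      ∫ y : ℝ × ℝ, ∫ ω, h (X.mode (c * y.1).toNNReal ω) * h (X.mode (c * y.2).toNNReal ω)
        ∂X.prob x ∂μ.prod μ := by
  have := X.isProbabilityMeasure_prob x
  have h₁ : Measurable fun y : ℝ × ℝ => (c * y.1).toNNReal := by fun_prop
  have h₂ : Measurable fun y : ℝ × ℝ => (c * y.2).toNNReal := by fun_prop
  have hint : Integrable (fun y : (ℝ × ℝ) × Ω => h (X.mode (c * y.1.1).toNNReal y.2) *
      h (X.mode (c * y.1.2).toNNReal y.2)) ((μ.prod μ).prod (X.prob x)) :=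
    Integrable.comp_aemeasurable (g := fun i : Fin z × Fin z => h i.1 * h i.2) .of_finite
      ((X.aemeasurable_mode_prod x (μ.prod μ) h₁).prodMk
        (X.aemeasurable_mode_prod x (μ.prod μ) h₂))
  have hsq : ∀ ω, (∫ s, h (X.mode (c * s).toNNReal ω) ∂μ) ^ 2 = ∫ y : ℝ × ℝ,
      h (X.mode (c * y.1).toNNReal ω) * h (X.mode (c * y.2).toNNReal ω) ∂μ.prod μ := fun ω => by
    rw [sq, ← integral_prod_mul]
  refine ⟨hint.integral_prod_left, ?_, ?_⟩
  · simp only [hsq]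
    exact hint.integral_prod_right
  · simp only [hsq]
    exact (integral_integral_swap hint).symm

variable {X}

/-- The mean ergodic theorem for centred functions of the mode. The correlations of the modes at
two distinct rescaled times `k * s` and `k * t` tend to zero, and dominated convergence applies. -/
theorem IsStable.tendsto_integral_sq (hX : X.IsStable) (x : HybridState m z) {h : Fin z → ℝ}
    (hh : ∑ i, N.steadyState i * h i = 0) :
    Tendsto (fun k : ℕ => ∫ ω, (∫ s in Set.Ioc (0 : ℝ) 1, h (X.mode (k * s).toNNReal ω)) ^ 2
      ∂X.prob x) atTop (𝓝 0) := by
  have := X.isProbabilityMeasure_prob x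
  set μ : Measure ℝ := volume.restrict (Set.Ioc (0 : ℝ) 1) with hμ
  have hM : ∀ i, |h i| ≤ ∑ i, |h i| := fun i =>
    Finset.single_le_sum (f := fun i => |h i|) (fun _ _ => abs_nonneg _) (Finset.mem_univ i)
  set M := ∑ i, |h i|
  have hdecay : Tendsto (fun t : ℝ≥0 =>
      M * ∑ i, |(NormedSpace.exp ((t : ℝ) • N.rate) *ᵥ h) i|) atTop (𝓝 0) := by
    have := (tendsto_finsetSum Finset.univ fun i _ =>
      (hX.tendsto_exp_mulVec h i).abs).const_mul M
    simpa [hh] using this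
  have hne : ∀ᵐ y : ℝ × ℝ ∂μ.prod μ, y.1 ≠ y.2 := by
    refine (Measure.ae_prod_mem_iff_ae_ae_mem (s := {y : ℝ × ℝ | y.1 ≠ y.2})
      (measurableSet_eq_fun measurable_fst measurable_snd).compl).2 (.of_forall fun s => ?_)
    filter_upwards [(Set.countable_singleton s).ae_notMem μ] with t ht hst
    exact ht hst.symm
  have hpos : ∀ᵐ y : ℝ × ℝ ∂μ.prod μ, 0 < y.1 ∧ 0 < y.2 := by
    have h₀ : ∀ᵐ s ∂μ, 0 < s := by
      filter_upwards [ae_restrict_mem measurableSet_Ioc] with s hs using hs.1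
    filter_upwards [Measure.quasiMeasurePreserving_fst.ae h₀,
      Measure.quasiMeasurePreserving_snd.ae h₀] with y h₁ h₂ using ⟨h₁, h₂⟩
  simp only [fun k : ℕ => (X.integral_sq_integral_comp_mode x h μ k).2.2]
  rw [show (0 : ℝ) = ∫ _ : ℝ × ℝ, (0 : ℝ) ∂μ.prod μ by simp]
  refine tendsto_integral_of_dominated_convergence (fun _ => M * M)
    (fun k => (X.integral_sq_integral_comp_mode x h μ k).1.aestronglyMeasurable)
    (integrable_const _) (fun k => .of_forall fun y => ?_) ?_
  · refine (norm_integral_le_of_norm_le_const (C := M * M) (.of_forall fun ω => ?_)).trans ?_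
    · rw [norm_mul]
      exact mul_le_mul (hM _) (hM _) (abs_nonneg _) ((abs_nonneg _).trans (hM (X.mode 0 ω)))
    · simp
  · filter_upwards [hne, hpos] with y hy ⟨h₁, h₂⟩
    have hdist : Tendsto (fun k : ℕ => nndist (k * y.1).toNNReal (k * y.2).toNNReal)
        atTop atTop := by
      have hk : ∀ k : ℕ, (nndist (k * y.1).toNNReal (k * y.2).toNNReal : ℝ) =
          k * |y.1 - y.2| := fun k => by
        rw [coe_nndist, NNReal.dist_eq, Real.coe_toNNReal _ (by positivity),
          Real.coe_toNNReal _ (by positivity), ← mul_sub, abs_mul, Nat.abs_cast]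
      rw [← NNReal.tendsto_coe_atTop]
      simp only [hk]
      exact tendsto_natCast_atTop_atTop.atTop_mul_const (abs_pos.2 (sub_ne_zero.2 hy))
    exact squeeze_zero_norm (fun k => X.abs_integral_comp_mode_mul_le x hM _ _)
      (hdecay.comp hdist)

/-- Time averages of a centred function of the mode tend to zero in probability. -/
theorem IsStable.tendstoInMeasure_average (hX : X.IsStable) (x : HybridState m z) {h : Fin z → ℝ}
    (hh : ∑ i, N.steadyState i * h i = 0) :
    TendstoInMeasure (X.prob x)
      (fun (k : ℕ) ω => (1 / k : ℝ) * ∫ s in (0 : ℝ)..k, h (X.mode s.toNNReal ω)) atTop 0 := by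
  have := X.isProbabilityMeasure_prob x
  have hscale : ∀ᶠ k : ℕ in atTop, ∀ ω,
      ∫ s in Set.Ioc (0 : ℝ) 1, h (X.mode (k * s).toNNReal ω) =
        (1 / k : ℝ) * ∫ s in (0 : ℝ)..k, h (X.mode s.toNNReal ω) := by
    filter_upwards [eventually_gt_atTop 0] with k hk ω
    have hk' : (k : ℝ) ≠ 0 := by positivity
    have := intervalIntegral.mul_integral_comp_mul_left (a := 0) (b := 1) (k : ℝ)
      (f := fun s => h (X.mode s.toNNReal ω))
    rw [mul_zero, mul_one, intervalIntegral.integral_of_le zero_le_one] at this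
    rw [← this]
    field_simp
  suffices H : TendstoInMeasure (X.prob x) (fun (k : ℕ) ω =>
      ∫ s in Set.Ioc (0 : ℝ) 1, h (X.mode (k * s).toNNReal ω)) atTop 0 from
    H.congr' (hscale.mono fun k hk => .of_forall hk) .rfl
  rw [tendstoInMeasure_iff_measureReal_norm]
  intro ε hε
  have hlim := (hX.tendsto_integral_sq x hh).const_mul (ε ^ 2)⁻¹
  rw [mul_zero] at hlim
  refine squeeze_zero (fun _ => measureReal_nonneg) (fun k => ?_) hlim
  have hcheb := mul_meas_ge_le_integral_of_nonneg (.of_forall fun ω => sq_nonneg _)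
    (X.integral_sq_integral_comp_mode x h (volume.restrict (Set.Ioc (0 : ℝ) 1)) k).2.1 (ε ^ 2)
  rw [inv_mul_eq_div, le_div_iff₀' (by positivity)]
  refine le_trans (le_of_eq ?_) hcheb
  congr 2
  ext ω
  simp only [Pi.zero_apply, sub_zero, Real.norm_eq_abs, Set.mem_ofPred_eq]
  rw [← sq_abs (∫ s in Set.Ioc (0 : ℝ) 1, h (X.mode (k * s).toNNReal ω)),
    sq_le_sq₀ hε.le (abs_nonneg _)]

/-! ### Queues -/

/-- Under stability the laws of the queue lengths are asymptotically tight, so that the queues are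
negligible at the scale of time. -/
theorem IsStable.tendstoInMeasure_queue_div (hX : X.IsStable) (x : HybridState m z) (e : Fin m) :
    TendstoInMeasure (X.prob x) (fun (k : ℕ) ω => (X.queue k ω e : ℝ) / k) atTop 0 := by
  obtain ⟨π, -, -, hπ⟩ := hX
  rw [tendstoInMeasure_iff_norm]
  intro ε hε
  refine ENNReal.tendsto_nhds_zero.2 fun δ hδ => ?_
  let F : ℕ → Set (HybridState m z) := fun K => {y | (K : ℝ≥0) ≤ y.2 e}
  have hF : ∀ K, IsClosed (F K) := fun K =>
    isClosed_le continuous_const ((continuous_apply e).comp continuous_snd)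
  have hF_tendsto : Tendsto (fun K => (π : Measure (HybridState m z)) (F K)) atTop (𝓝 0) := by
    have hempty : ⋂ K, F K = ∅ := by
      refine Set.eq_empty_of_forall_notMem fun y hy => ?_
      obtain ⟨K, hK⟩ := exists_nat_gt (y.2 e)
      exact absurd (Set.mem_iInter.1 hy K) (not_le.2 hK)
    have := tendsto_measure_iInter_atTop (μ := (π : Measure (HybridState m z))) (s := F)
      (fun K => (hF K).measurableSet.nullMeasurableSet)
      (fun K L hKL y (hy : (L : ℝ≥0) ≤ y.2 e) =>
        show (K : ℝ≥0) ≤ y.2 e from (Nat.cast_le.2 hKL).trans hy) ⟨0, measure_ne_top _ _⟩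
    rwa [hempty, measure_empty] at this
  obtain ⟨K, hK⟩ := (hF_tendsto.eventually_lt_const hδ).exists
  have hlim : limsup (fun k : ℕ => (X.stateLaw x k : Measure (HybridState m z)) (F K)) atTop < δ :=
    (ProbabilityMeasure.limsup_measure_closed_le_of_tendsto
      ((hπ x).comp tendsto_natCast_atTop_atTop) (hF K)).trans_lt hK
  obtain ⟨k₀, hk₀⟩ := exists_nat_gt (K / ε)
  filter_upwards [eventually_lt_of_limsup_lt hlim, eventually_ge_atTop (max k₀ 1)] with k h₁ h₂
  refine le_trans ?_ h₁.le
  change _ ≤ X.transition k x (F K)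
  rw [transition, Kernel.map_apply' _ (X.measurable_state k) _ (hF K).measurableSet]
  refine measure_mono fun ω hω => ?_
  have hk : (0 : ℝ) < k := Nat.cast_pos.2 (by omega)
  have hk' : (k₀ : ℝ) ≤ k := Nat.cast_le.2 (by omega)
  have hq : ε ≤ (X.queue k ω e : ℝ) / k := by
    simpa [abs_of_nonneg (div_nonneg (X.queue k ω e).2 hk.le)] using hω
  rw [le_div_iff₀ hk] at hq
  rw [div_lt_iff₀ hε] at hk₀
  have : (K : ℝ) ≤ X.queue k ω e := by nlinarith
  exact_mod_cast this

end PDQProcess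

/-! ### Average flows along paths -/

theorem PDQNetwork.IsAdmissible.measurable_discharge {n m z : ℕ} {N : PDQNetwork n m z}
    {φ : RoutingPolicy m z} {d : Fin z → QueueVector m → Fin m → ℝ} (hφ : N.IsAdmissible φ d)
    (e : Fin m) : Measurable fun y : HybridState m z => N.discharge φ y.1 y.2 e := by
  refine measurable_from_prod_countable_right fun i => ?_
  exact Measurable.ite (measurableSet_lt measurable_const (measurable_pi_apply e))
    (measurable_const (a := N.capacity i e))
    (((measurable_pi_apply e).comp (hφ.measurable i)).min (measurable_const (a := N.capacity i e)))

theorem PDQNetwork.discharge_le_capacity {n m z : ℕ} (N : PDQNetwork n m z)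
    (φ : RoutingPolicy m z) (i : Fin z) (q : QueueVector m) (e : Fin m) :
    N.discharge φ i q e ≤ N.capacity i e := by
  unfold discharge
  split_ifs
  · exact le_rfl
  · exact min_le_right _ _

namespace PDQProcess

variable {n m z : ℕ} {N : PDQNetwork n m z} {φ : RoutingPolicy m z}
  {Ω : Type*} [MeasurableSpace Ω] (X : PDQProcess N φ Ω)

theorem ae_intervalIntegrable_comp_mode (x : HybridState m z) (h : Fin z → ℝ) :
    ∀ᵐ ω ∂X.prob x, ∀ a b : ℝ,
      IntervalIntegrable (fun s => h (X.mode s.toNNReal ω)) volume a b := by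
  filter_upwards [X.ae_aemeasurable_mode x] with ω hω a b
  rw [intervalIntegrable_iff, Set.uIoc, IntegrableOn]
  exact Integrable.comp_aemeasurable .of_finite hω.restrict

/-- The queue is the accumulated inflow less the accumulated discharge, and the discharge is at
most the capacity; hence the average inflow is at most the average capacity up to the term
`q_e(T) / T`. -/
theorem ae_averageFlow_le {d : Fin z → QueueVector m → Fin m → ℝ} (hφ : N.IsAdmissible φ d)
    (x : HybridState m z) :
    ∀ᵐ ω ∂X.prob x, ∀ (e : Fin m) (T : ℝ≥0), 0 < T →
      X.averageFlow e T ω ≤ (X.queue T ω e : ℝ) / T +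
        (1 / T : ℝ) * ∫ s in (0 : ℝ)..T, (N.capacity (X.mode s.toNNReal ω) e : ℝ) := by
  filter_upwards [X.dynamics x, X.ae_aemeasurable_mode x,
    ae_all_iff.2 fun e => X.ae_intervalIntegrable_comp_mode x fun i => (N.capacity i e : ℝ)]
    with ω hdyn hmode hcap e T hT
  have hT0 : (0 : ℝ) ≤ T := T.2
  -- The queue path is continuous, because it is a primitive.
  have hqueue : AEMeasurable (fun s : ℝ => X.queue s.toNNReal ω)
      (volume.restrict (Set.Ioc (0 : ℝ) T)) := by
    refine aemeasurable_pi_lambda _ fun e => ?_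
    have hcont := (intervalIntegral.continuousOn_primitive_interval' (hdyn T e).1
      Set.left_mem_uIcc).const_add (X.queue 0 ω e : ℝ)
    rw [Set.uIcc_of_le hT0] at hcont
    have hmeas := ((hcont.mono Set.Ioc_subset_Icc_self).aemeasurable measurableSet_Ioc
      (μ := volume)).real_toNNReal
    refine hmeas.congr ?_
    filter_upwards [ae_restrict_mem measurableSet_Ioc] with s hs
    have := (hdyn s.toNNReal e).2
    rw [Real.coe_toNNReal s hs.1.le] at this
    rw [← this, Real.toNNReal_coe]
  have hr : IntervalIntegrable (fun s : ℝ =>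
      (N.discharge φ (X.mode s.toNNReal ω) (X.queue s.toNNReal ω) e : ℝ)) volume 0 T := by
    rw [intervalIntegrable_iff_integrableOn_Ioc_of_le hT0]
    refine Integrable.mono'
      ((intervalIntegrable_iff_integrableOn_Ioc_of_le hT0).1 (hcap e 0 T)) ?_
      (.of_forall fun s => ?_)
    · exact ((hφ.measurable_discharge e).comp_aemeasurable
        (hmode.restrict.prodMk hqueue)).coe_nnreal_real.aestronglyMeasurable
    · rw [Real.norm_of_nonneg (NNReal.coe_nonneg _)]
      exact NNReal.coe_le_coe.2 (N.discharge_le_capacity φ _ _ e)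
  have hin : IntervalIntegrable (fun s : ℝ =>
      (φ (X.mode s.toNNReal ω) (X.queue s.toNNReal ω) e : ℝ)) volume 0 T := by
    simpa using (hdyn T e).1.add hr
  have hle := intervalIntegral.integral_mono_on hT0 hr (hcap e 0 T) fun s _ =>
    NNReal.coe_le_coe.2 (N.discharge_le_capacity φ _ _ e)
  have hq := (hdyn T e).2
  rw [intervalIntegral.integral_sub hin hr] at hq
  have hq0 : (0 : ℝ) ≤ X.queue 0 ω e := NNReal.coe_nonneg _
  have hT' : (0 : ℝ) < T := hT
  rw [averageFlow, div_eq_mul_one_div (X.queue T ω e : ℝ), mul_comm (X.queue T ω e : ℝ), ← mul_add]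
  gcongr
  linarith

variable {X}

/-- Convergence in probability yields almost sure convergence along a subsequence of times, and
this is enough to bound the lower limit of the average flow. -/
theorem IsStable.ae_liminf_averageFlow_le (hX : X.IsStable)
    {d : Fin z → QueueVector m → Fin m → ℝ} (hφ : N.IsAdmissible φ d) (x : HybridState m z) :
    ∀ᵐ ω ∂X.prob x, ∀ e,
      liminf (fun T : ℝ => (X.averageFlow e T ω : EReal)) atTop ≤ (N.meanCapacity e : EReal) := by
  refine ae_all_iff.2 fun e => ?_
  have hcentred : ∑ i, N.steadyState i * ((N.capacity i e : ℝ) - N.meanCapacity e) = 0 := by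
    simp only [mul_sub, Finset.sum_sub_distrib, ← Finset.sum_mul]
    rw [N.isStationaryDistribution_steadyState.2.1, one_mul]
    exact sub_self _
  obtain ⟨k₁, hk₁, hae₁⟩ := (hX.tendstoInMeasure_average x hcentred).exists_seq_tendsto_ae
  obtain ⟨k₂, hk₂, hae₂⟩ :=
    ((hX.tendstoInMeasure_queue_div x e).comp hk₁.tendsto_atTop).exists_seq_tendsto_ae
  filter_upwards [hae₁, hae₂, X.ae_averageFlow_le hφ x,
    X.ae_intervalIntegrable_comp_mode x fun i => (N.capacity i e : ℝ)] with ω h₁ h₂ hle hcap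
  have hk : Tendsto (fun l => k₁ (k₂ l)) atTop atTop := (hk₁.comp hk₂).tendsto_atTop
  have hbound : Tendsto (fun l => (X.queue (k₁ (k₂ l)) ω e : ℝ) / (k₁ (k₂ l) : ℕ) +
      ((1 / (k₁ (k₂ l) : ℕ) : ℝ) * ∫ s in (0 : ℝ)..(k₁ (k₂ l) : ℕ),
        ((N.capacity (X.mode s.toNNReal ω) e : ℝ) - N.meanCapacity e)) + N.meanCapacity e)
      atTop (𝓝 (N.meanCapacity e)) := by
    simpa using (h₂.add (h₁.comp hk₂.tendsto_atTop)).add_const (N.meanCapacity e)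
  calc liminf (fun T : ℝ => (X.averageFlow e T ω : EReal)) atTop
      ≤ liminf (fun l => (X.averageFlow e (k₁ (k₂ l) : ℕ) ω : EReal)) atTop :=
        liminf_le_liminf_of_le (tendsto_natCast_atTop_atTop.comp hk)
    _ ≤ liminf (fun l => (((X.queue (k₁ (k₂ l)) ω e : ℝ) / (k₁ (k₂ l) : ℕ) +
          ((1 / (k₁ (k₂ l) : ℕ) : ℝ) * ∫ s in (0 : ℝ)..(k₁ (k₂ l) : ℕ),
            ((N.capacity (X.mode s.toNNReal ω) e : ℝ) - N.meanCapacity e)) +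
          N.meanCapacity e : ℝ) : EReal)) atTop := by
        refine liminf_le_liminf ?_
        filter_upwards [hk.eventually_gt_atTop 0] with l hl
        refine EReal.coe_le_coe_iff.2 ?_
        have := hle e (k₁ (k₂ l) : ℕ) (Nat.cast_pos.2 hl)
        rw [NNReal.coe_natCast] at this
        refine this.trans (le_of_eq ?_)
        have hl' : ((k₁ (k₂ l) : ℕ) : ℝ) ≠ 0 := by positivity
        rw [intervalIntegral.integral_sub (hcap _ _) intervalIntegrable_const,
          intervalIntegral.integral_const, smul_eq_mul]
        field_simp
        ring
    _ = N.meanCapacity e := ((continuous_coe_real_ereal.tendsto _).comp hbound).liminf_eq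

end PDQProcess

theorem mainTheorem2 {n m z : ℕ} (N : PDQNetwork n m z) (φ : RoutingPolicy m z)
    (d : Fin z → QueueVector m → Fin m → ℝ) (hφ : N.IsAdmissible φ d)
    {Ω : Type*} [MeasurableSpace Ω] (X : PDQProcess N φ Ω) (hX : X.IsStable)
    (x : HybridState m z) :
    (∀ f : Fin m → ℝ, X.IsTimeAverageFlow x f → f ≤ N.meanCapacity) ∧
      ∀ᵐ ω ∂X.prob x, ∀ e,
        liminf (fun T : ℝ => (X.averageFlow e T ω : EReal)) atTop ≤ (N.meanCapacity e : EReal) := by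
  have := X.isProbabilityMeasure_prob x
  have hlim := hX.ae_liminf_averageFlow_le hφ x
  refine ⟨fun f hf e => ?_, hlim⟩
  obtain ⟨ω, hω, hle⟩ := (Filter.Eventually.and hf hlim).exists
  rw [← EReal.coe_le_coe_iff,
    ← ((continuous_coe_real_ereal.tendsto _).comp (hω e)).liminf_eq]
  exact hle e
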